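/- Let $h_0\colon[-e^{-1},e^{-1}]\to\mathbb R$ be given by $h_0(x)=|x|\,\bigl(\log\bigl|\log\frac{|x|}{e}\bigr|\bigr)^{-1/2}$ for $x\neq 0$ and $h_0(0)=0$; it is a $C^1$-function. Let $\ell^2_N$ denote $\mathbb C^N$ with its standard Hilbert space structure and let $\|\cdot\|_\infty$ denote the operator norm on $B(\ell^2_N)$. There is a constant $c>0$ such that for every $2\pi$-periodic $C^1$-function $h\colon\mathbb R\to\mathbb R$ with $h=h_0$ on $[-e^{-1},e^{-1}]$ and every integer $n\geq 3$, there exist self-adjoint operators $A_n,B_n\in B(\ell^2_{2n+1})$ such that $B_n\neq 0$, $0\in\sigma(A_n)$, $$\|h(A_n+B_n)-h(A_n)\|_\infty\ \geq\ c\,(\log n)^{1/2}\,\|B_n\|_\infty ,$$ and there exists a unitary operator $S_n\in B(\ell^2_{2n+1})$ with $A_n+B_n=S_n^{-1}A_nS_n$. Here $h(A_n)$ and $h(A_n+B_n)$ are defined by the functional calculus of self-adjoint operators. -/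

import Mathlib

/-- The space `B(ℓ²_N)` of operators on `ℂ^N` with its standard Hilbert space structure.
Its norm is the operator norm, i.e. the Schatten `∞`-norm. -/
abbrev OpL2 (N : ℕ) : Type :=
  EuclideanSpace ℂ (Fin N) →L[ℂ] EuclideanSpace ℂ (Fin N)

/-- The function `x ↦ |x| (log |log (|x| / e)|) ^ (-1/2)`, with value `0` at `0`. It is only
used on the interval `[-e⁻¹, e⁻¹]`, on which `|log (|x| / e)| ≥ 2` for `x ≠ 0`. -/
noncomputable def hFormula (x : ℝ) : ℝ :=
  if x = 0 then 0
  else |x| * (Real.log |Real.log (|x| / Real.exp 1)|) ^ (-(1 / 2) : ℝ)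

/-- `h` is a `2π`-periodic `C¹` function on `ℝ` which extends the restriction of `hFormula`
to `[-e⁻¹, e⁻¹]`. -/
structure IsPeriodicExtension (h : ℝ → ℝ) : Prop where
  contDiff : ContDiff ℝ 1 h
  periodic : Function.Periodic h (2 * Real.pi)
  eqOn : Set.EqOn h hFormula (Set.Icc (-(Real.exp 1)⁻¹) (Real.exp 1)⁻¹)

/-! ### From commutators to unitary conjugates -/

section Cayley

variable {𝔄 : Type*} [CStarAlgebra 𝔄]

/-! It suffices to find self-adjoint `A`, `X` with `[h(A), X]` much larger than `[A, X]`: the Cayley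
transform `S` of the rescaled `X` has comparable commutators, and `‖S⁻¹cS - c‖ = ‖[c, S]‖` for `c =
A` and `c = h(A)`. This is `exists_perturbation_of_norm_commutator_le`.

Let `A` be diagonal with eigenvalues `±λ_i`, `λ_i = exp (-(i + 1))`, and `0`. Choose `X`
off-diagonal so that the corner of `[A, X]` is the discrete Hilbert matrix `Z`, which is unitary;
hence `‖[A, X]‖ ≤ 1`. As `h` is even near `0`, the same corner of `[h(A), X]` has entries `(h(λ_i) -
h(λ_j)) / (λ_i + λ_j) * Z i j`. Both factors change sign with `j - i`, so the products are
nonnegative, of size at least a constant times `(log n)^(-1/2) / |j - i|`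
(`le_hFormula_sub_div_mul_inv_sin`). Testing on constant vectors sums the harmonic series and gives
`(log n)^(-1/2) * log n` (`le_norm_commutator_testMatrix`). -/

theorem IsSelfAdjoint.one_sub_I_mul_ne_zero {x : 𝔄} (hx : IsSelfAdjoint x) {z : ℂ}
    (hz : z ∈ spectrum ℂ x) : 1 - Complex.I * z ≠ 0 := by
  rw [hx.mem_spectrum_eq_re hz]
  intro h
  simpa using congrArg Complex.re h

/-- The spectrum of `1 - ix` lies on the line `Re = 1`, at distance at least `1` from `0`. -/
theorem IsSelfAdjoint.exists_norm_le_one_inverse_one_sub_I_smul {x : 𝔄} (hx : IsSelfAdjoint x) :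
    ∃ r : 𝔄, ‖r‖ ≤ 1 ∧ r * (1 - Complex.I • x) = 1 ∧ (1 - Complex.I • x) * r = 1 := by
  have hn := hx.isStarNormal
  have hc : ContinuousOn (fun z : ℂ ↦ (1 - Complex.I * z)⁻¹) (spectrum ℂ x) :=
    ContinuousOn.inv₀ (by fun_prop) fun z hz ↦ hx.one_sub_I_mul_ne_zero hz
  have he : cfc (fun z : ℂ ↦ 1 - Complex.I * z) x = 1 - Complex.I • x := by
    rw [cfc_sub (fun _ : ℂ ↦ (1 : ℂ)) (fun z ↦ Complex.I * z) x, cfc_const_one ℂ x,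
      cfc_const_mul_id Complex.I x]
  refine ⟨cfc (fun z : ℂ ↦ (1 - Complex.I * z)⁻¹) x, ?_, ?_, ?_⟩
  · refine norm_cfc_le zero_le_one fun z hz ↦ ?_
    rw [norm_inv]
    refine inv_le_one_of_one_le₀ ?_
    rw [hx.mem_spectrum_eq_re hz]
    refine le_trans ?_ (Complex.abs_re_le_norm _)
    simp
  · rw [← he, ← cfc_mul _ _ x hc, ← cfc_const_one ℂ x]
    exact cfc_congr fun z hz ↦ inv_mul_cancel₀ (hx.one_sub_I_mul_ne_zero hz)
  · rw [← he, ← cfc_mul _ _ x (by fun_prop) hc, ← cfc_const_one ℂ x]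
    exact cfc_congr fun z hz ↦ mul_inv_cancel₀ (hx.one_sub_I_mul_ne_zero hz)

/-- The Cayley transform `s` of a self-adjoint contraction `x` has commutators comparable to
those of `x`. -/
theorem IsSelfAdjoint.exists_unitary_norm_commutator {x : 𝔄} (hx : IsSelfAdjoint x)
    (hx1 : ‖x‖ ≤ 1) :
    ∃ s : unitary 𝔄, ∀ a : 𝔄, ‖a * s - s * a‖ ≤ 2 * ‖a * x - x * a‖ ∧
      ‖a * x - x * a‖ ≤ 2 * ‖a * s - s * a‖ := by
  obtain ⟨r, hr, hr1, hr2⟩ := hx.exists_norm_le_one_inverse_one_sub_I_smul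
  set y : 𝔄 := 1 - Complex.I • x with hy
  have hstar : star y = 2 - y := by
    have : (2 : 𝔄) = 1 + 1 := one_add_one_eq_two.symm
    rw [hy, star_sub, star_one, star_smul, hx.star_eq, this]
    simp
  have hs1 : star r * (2 - y) = 1 := by rw [← hstar, ← star_mul, hr2, star_one]
  have hs2 : (2 - y) * star r = 1 := by rw [← hstar, ← star_mul, hr1, star_one]
  have hsstar : star (2 * r - 1) = 2 * star r - 1 := by
    rw [star_sub, star_mul, star_one, star_ofNat, mul_two, two_mul]
  have e1 : 2 * star r - 1 = star r * y := by
    have : star r * y = star r * 2 - star r * (2 - y) := by noncomm_ring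
    rw [this, hs1, mul_two, two_mul]
  have e1' : 2 * star r - 1 = y * star r := by
    have : y * star r = 2 * star r - (2 - y) * star r := by noncomm_ring
    rw [this, hs2]
  have e2 : 2 * r - 1 = (2 - y) * r := by
    rw [sub_mul, hr2]
  have e2' : 2 * r - 1 = r * (2 - y) := by
    rw [mul_sub, hr1, mul_two, two_mul]
  -- Since `2 - y = 1 + ix`, the element `2r - 1` is the Cayley transform `(1 + ix)(1 - ix)⁻¹`.
  have hu : 2 * r - 1 ∈ unitary 𝔄 := by
    rw [Unitary.mem_iff, hsstar]
    constructor
    · rw [e1, e2']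
      calc star r * y * (r * (2 - y)) = star r * (y * r) * (2 - y) := by noncomm_ring
        _ = 1 := by rw [hr2, mul_one, hs1]
    · rw [e2', e1']
      calc r * (2 - y) * (y * star r) = r * y * ((2 - y) * star r) := by noncomm_ring
        _ = 1 := by rw [hr1, hs2, mul_one]
  have hny : ‖y‖ ≤ 2 := by
    rcases subsingleton_or_nontrivial 𝔄 with h | h
    · rw [Subsingleton.elim y 0, norm_zero]; norm_num
    · calc ‖y‖ ≤ ‖(1 : 𝔄)‖ + ‖Complex.I • x‖ := norm_sub_le _ _
        _ ≤ 1 + 1 := by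
          rw [norm_smul, Complex.norm_I, one_mul, CStarRing.norm_one]; gcongr
        _ = 2 := by norm_num
  refine ⟨⟨2 * r - 1, hu⟩, fun a ↦ ?_⟩
  have hc : Complex.I • (a * x - x * a) = y * a - a * y := by
    rw [hy]
    simp only [sub_mul, mul_sub, one_mul, mul_one, smul_mul_assoc, mul_smul_comm, smul_sub]
    abel
  have hcn : ‖a * x - x * a‖ = ‖y * a - a * y‖ := by
    rw [← hc, norm_smul, Complex.norm_I, one_mul]
  have hd : a * (2 * r - 1) - (2 * r - 1) * a = (2 : ℂ) • (a * r - r * a) := by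
    rw [two_smul]; noncomm_ring
  have hdn : ‖a * (2 * r - 1) - (2 * r - 1) * a‖ = 2 * ‖a * r - r * a‖ := by
    rw [hd, norm_smul]; simp
  -- The commutator acts as a derivation on the inverse. With `‖r‖ ≤ 1` and `‖y‖ ≤ 2` this identity
  -- and its converse give both bounds.
  have h1 : a * r - r * a = r * (y * a - a * y) * r := by
    calc a * r - r * a = (r * y) * a * r - r * a * (y * r) := by rw [hr1, hr2]; simp
      _ = _ := by noncomm_ring
  have h2 : y * a - a * y = y * (a * r - r * a) * y := by
    calc y * a - a * y = y * a * (r * y) - (y * r) * a * y := by rw [hr1, hr2]; simp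
      _ = _ := by noncomm_ring
  simp only [hdn, hcn]
  constructor
  · gcongr
    calc ‖a * r - r * a‖ ≤ ‖r‖ * ‖y * a - a * y‖ * ‖r‖ := by
          rw [h1]; exact norm_mul₃_le
      _ ≤ 1 * ‖y * a - a * y‖ * 1 := by gcongr
      _ = _ := by ring
  · calc ‖y * a - a * y‖ ≤ ‖y‖ * ‖a * r - r * a‖ * ‖y‖ := by
          conv_lhs => rw [h2]
          exact norm_mul₃_le
      _ ≤ 2 * ‖a * r - r * a‖ * 2 := by gcongr
      _ = _ := by ring

theorem cfc_unitary_inv_conj {h : ℝ → ℝ} (hh : Continuous h) {a : 𝔄} (ha : IsSelfAdjoint a)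
    (s : unitary 𝔄) :
    cfc h (((s⁻¹ : unitary 𝔄) : 𝔄) * a * s) = ((s⁻¹ : unitary 𝔄) : 𝔄) * cfc h a * s := by
  have hconj : ∀ c : 𝔄, Unitary.conjStarAlgAut ℂ 𝔄 (star s) c =
      ((s⁻¹ : unitary 𝔄) : 𝔄) * c * s := fun c ↦ Unitary.conjStarAlgAut_star_apply s c
  have hcont : Continuous (Unitary.conjStarAlgAut ℂ 𝔄 (star s)) := by
    rw [show ⇑(Unitary.conjStarAlgAut ℂ 𝔄 (star s)) = _ from funext hconj]
    fun_prop
  rw [← hconj, ← hconj]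
  exact (StarAlgHomClass.map_cfc (S := ℂ) (Unitary.conjStarAlgAut ℂ 𝔄 (star s)) h a
    hh.continuousOn hcont ha (ha.map _)).symm

/-- A lower bound for the commutator of `cfc h a` with a self-adjoint `x` yields a unitary
conjugate `a + b` of `a` for which `cfc h` is expanding. -/
theorem exists_perturbation_of_norm_commutator_le {h : ℝ → ℝ} (hh : Continuous h) {a x : 𝔄}
    (ha : IsSelfAdjoint a) (hx : IsSelfAdjoint x) {K : ℝ} (hK : 0 ≤ K)
    (hne : cfc h a * x - x * cfc h a ≠ 0)
    (hle : K * ‖a * x - x * a‖ ≤ ‖cfc h a * x - x * cfc h a‖) :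
    ∃ b : 𝔄, IsSelfAdjoint b ∧ b ≠ 0 ∧ K / 4 * ‖b‖ ≤ ‖cfc h (a + b) - cfc h a‖ ∧
      ∃ s : unitary 𝔄, a + b = ((s⁻¹ : unitary 𝔄) : 𝔄) * a * s := by
  have hx0 : x ≠ 0 := by rintro rfl; simp at hne
  have hxn : 0 < ‖x‖ := norm_pos_iff.2 hx0
  -- The hypothesis `hle` is homogeneous in `x`, so `x` may be normalised.
  obtain ⟨s, hs⟩ := IsSelfAdjoint.exists_unitary_norm_commutator (x := (‖x‖⁻¹ : ℝ) • x)
    ((IsSelfAdjoint.all _).smul hx) (by rw [norm_smul, norm_inv, norm_norm, inv_mul_cancel₀ hxn.ne'])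
  have hscale : ∀ c : 𝔄, ‖c * ((‖x‖⁻¹ : ℝ) • x) - ((‖x‖⁻¹ : ℝ) • x) * c‖ =
      ‖x‖⁻¹ * ‖c * x - x * c‖ := fun c ↦ by
    rw [mul_smul_comm, smul_mul_assoc, ← smul_sub, norm_smul, norm_inv, norm_norm]
  simp only [hscale] at hs
  have hconj : ∀ c : 𝔄, ‖((s⁻¹ : unitary 𝔄) : 𝔄) * c * s - c‖ = ‖c * s - s * c‖ := fun c ↦ by
    have : ((s⁻¹ : unitary 𝔄) : 𝔄) * c * s - c = ((s⁻¹ : unitary 𝔄) : 𝔄) * (c * s - s * c) := by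
      rw [mul_sub, ← mul_assoc, ← mul_assoc, ← Submonoid.coe_mul, inv_mul_cancel]; simp
    rw [this, CStarRing.norm_coe_unitary_mul]
  set b : 𝔄 := ((s⁻¹ : unitary 𝔄) : 𝔄) * a * s - a with hb
  have hab : a + b = ((s⁻¹ : unitary 𝔄) : 𝔄) * a * s := by rw [hb]; abel
  have hdiff : ‖cfc h (a + b) - cfc h a‖ = ‖cfc h a * s - s * cfc h a‖ := by
    rw [hab, cfc_unitary_inv_conj hh ha, hconj]
  have h1 := (hs a).1
  have h2 := (hs (cfc h a)).2
  refine ⟨b, ?_, ?_, ?_, s, hab⟩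
  · refine IsSelfAdjoint.sub ?_ ha
    exact ha.conjugate' (s : 𝔄)
  · intro h0
    rw [h0, add_zero, sub_self, norm_zero] at hdiff
    rw [← hdiff, mul_zero] at h2
    have : 0 < ‖x‖⁻¹ * ‖cfc h a * x - x * cfc h a‖ := by
      have := norm_pos_iff.2 hne
      positivity
    linarith
  · rw [hdiff, hb, hconj]
    -- Passing from `x` to `s` costs a factor 2 for `a` and another for `cfc h a`, hence `K / 4`.
    have : ‖x‖⁻¹ * (K * ‖a * x - x * a‖) ≤ ‖x‖⁻¹ * ‖cfc h a * x - x * cfc h a‖ := by gcongr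
    have h3 := mul_le_mul_of_nonneg_left h1 hK
    nlinarith

end Cayley

/-! ### Exponential sums over odd frequencies -/

section TrigSums

/-- The factor equals `exp (iθ) - exp (-iθ)`, which makes the sum telescope. -/
theorem sum_exp_odd_mul_sin (θ : ℂ) (n : ℕ) :
    (∑ k ∈ Finset.range n, Complex.exp ((2 * k + 1) * θ * Complex.I)) *
      (2 * Complex.I * Complex.sin θ) = Complex.exp (2 * n * θ * Complex.I) - 1 := by
  have hs : 2 * Complex.I * Complex.sin θ =
      Complex.exp (θ * Complex.I) - Complex.exp (-θ * Complex.I) := by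
    rw [Complex.sin]
    linear_combination (Complex.exp (-θ * Complex.I) - Complex.exp (θ * Complex.I)) *
      Complex.I_mul_I
  induction n with
  | zero => simp
  | succ n ih =>
    rw [Finset.sum_range_succ, add_mul, ih, hs, mul_sub, ← Complex.exp_add, ← Complex.exp_add]
    have e1 : (2 * (n : ℂ) + 1) * θ * Complex.I + θ * Complex.I =
      2 * ((n + 1 : ℕ) : ℂ) * θ * Complex.I := by push_cast; ring
    have e2 : (2 * (n : ℂ) + 1) * θ * Complex.I + -θ * Complex.I =
      2 * (n : ℂ) * θ * Complex.I := by ring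
    rw [e1, e2]; ring

theorem sum_exp_odd_eq_zero {n : ℕ} {m : ℤ} (hm : m ≠ 0) (hmn : |m| < n) :
    ∑ k ∈ Finset.range n, Complex.exp ((2 * k + 1) * ((Real.pi * m / n : ℝ) : ℂ) * Complex.I) =
      0 := by
  have hn : (0 : ℝ) < n := by
    have : (0 : ℤ) < n := (abs_nonneg m).trans_lt hmn
    exact_mod_cast this
  have hlt : |(m : ℝ)| < n := by exact_mod_cast hmn
  have habs : |Real.pi * m / n| < Real.pi := by
    rw [abs_div, abs_mul, abs_of_pos hn, abs_of_pos Real.pi_pos, div_lt_iff₀ hn]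
    exact mul_lt_mul_of_pos_left hlt Real.pi_pos
  have hsin : Real.sin (Real.pi * m / n) ≠ 0 := by
    rw [abs_lt] at habs
    rw [Ne, Real.sin_eq_zero_iff_of_lt_of_lt habs.1 habs.2]
    have : (m : ℝ) ≠ 0 := by exact_mod_cast hm
    have := Real.pi_pos
    positivity
  have h := sum_exp_odd_mul_sin ((Real.pi * m / n : ℝ) : ℂ) n
  have he : 2 * (n : ℂ) * ((Real.pi * m / n : ℝ) : ℂ) * Complex.I =
      m * (2 * Real.pi * Complex.I) := by
    have : (n : ℂ) ≠ 0 := by exact_mod_cast hn.ne'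
    push_cast; field_simp
  rw [he, Complex.exp_int_mul_two_pi_mul_I, sub_self, ← Complex.ofReal_sin] at h
  exact (mul_eq_zero.1 h).resolve_right
    (mul_ne_zero (by simp) (Complex.ofReal_ne_zero.2 hsin))

/-- The half-integer shift makes the final exponential `-1`, so the telescoped value is `-2` instead
of `0`. -/
theorem neg_I_mul_sum_exp_odd {n : ℕ} (hn : 0 < n) (m : ℤ)
    (hs : Real.sin (Real.pi * (m + 1 / 2) / n) ≠ 0) :
    -Complex.I * ∑ k ∈ Finset.range n,
      Complex.exp ((2 * k + 1) * ((Real.pi * (m + 1 / 2) / n : ℝ) : ℂ) * Complex.I) =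
      ((Real.sin (Real.pi * (m + 1 / 2) / n))⁻¹ : ℝ) := by
  have h := sum_exp_odd_mul_sin ((Real.pi * (m + 1 / 2) / n : ℝ) : ℂ) n
  have he : 2 * (n : ℂ) * ((Real.pi * (m + 1 / 2) / n : ℝ) : ℂ) * Complex.I =
      m * (2 * Real.pi * Complex.I) + Real.pi * Complex.I := by
    have : (n : ℂ) ≠ 0 := by exact_mod_cast hn.ne'
    push_cast; field_simp
  rw [he, Complex.exp_add, Complex.exp_int_mul_two_pi_mul_I, Complex.exp_pi_mul_I,
    ← Complex.ofReal_sin] at h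
  have hs' : (Real.sin (Real.pi * (m + 1 / 2) / n) : ℂ) ≠ 0 := by exact_mod_cast hs
  rw [Complex.ofReal_inv]
  refine eq_inv_of_mul_eq_one_left ?_
  linear_combination (-1 / 2) * h

end TrigSums

/-! ### Unitarity of the discrete Hilbert matrix -/

section CauchyMatrix

open Matrix

/-- The Fourier matrix at the odd multiples of `π / n`. -/
noncomputable def oddFourierMatrix (n : ℕ) : Matrix (Fin n) (Fin n) ℂ :=
  Matrix.of fun k j ↦ ((√n : ℝ) : ℂ)⁻¹ *
    Complex.exp ((2 * (k : ℕ) + 1) * ((Real.pi * (j : ℕ) / n : ℝ) : ℂ) * Complex.I)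

/-- The discrete Hilbert matrix with entries `1 / (n sin (π (j - i + 1/2) / n))`. -/
noncomputable def discreteHilbertMatrix (n : ℕ) : Matrix (Fin n) (Fin n) ℂ :=
  Matrix.of fun i j ↦
    (((n * Real.sin (Real.pi * (((j : ℕ) : ℝ) - ((i : ℕ) : ℝ) + 1 / 2) / n))⁻¹ : ℝ) : ℂ)

theorem star_exp_ofReal_mul_ofReal_mul_I (x y : ℝ) :
    star (Complex.exp ((x : ℂ) * y * Complex.I)) = Complex.exp (-((x : ℂ) * y * Complex.I)) := by
  rw [Complex.star_def, ← Complex.exp_conj]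
  simp

theorem star_oddFourierMatrix_mul_apply (n : ℕ) (i j k : Fin n) :
    star (oddFourierMatrix n k i) * oddFourierMatrix n k j = (n : ℂ)⁻¹ *
      Complex.exp ((2 * (k : ℕ) + 1) *
        ((Real.pi * (((j : ℕ) : ℤ) - ((i : ℕ) : ℤ) : ℤ) / n : ℝ) : ℂ) * Complex.I) := by
  have hn : ((√n : ℝ) : ℂ)⁻¹ * ((√n : ℝ) : ℂ)⁻¹ = (n : ℂ)⁻¹ := by
    rw [← mul_inv, ← Complex.ofReal_mul, Real.mul_self_sqrt (Nat.cast_nonneg n)]; simp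
  have hc := star_exp_ofReal_mul_ofReal_mul_I (2 * (k : ℕ) + 1) (Real.pi * (i : ℕ) / n)
  push_cast at hc
  simp only [oddFourierMatrix, of_apply, star_mul', star_inv₀, Complex.star_def,
    Complex.conj_ofReal]
  rw [mul_mul_mul_comm, hn]
  congr 1
  rw [← Complex.star_def]
  push_cast
  rw [hc, ← Complex.exp_add]
  congr 1
  ring

theorem conjTranspose_oddFourierMatrix_mul_self {n : ℕ} :
    (oddFourierMatrix n)ᴴ * oddFourierMatrix n = 1 := by
  ext i j
  have hn : (n : ℂ) ≠ 0 := by exact_mod_cast (Fin.pos i).ne'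
  simp only [mul_apply, conjTranspose_apply, star_oddFourierMatrix_mul_apply]
  rw [← Finset.mul_sum, Fin.sum_univ_eq_sum_range (fun k ↦ Complex.exp ((2 * (k : ℕ) + 1) *
        ((Real.pi * (((j : ℕ) : ℤ) - ((i : ℕ) : ℤ) : ℤ) / n : ℝ) : ℂ) * Complex.I)) n]
  rcases eq_or_ne i j with rfl | hij
  · simp [hn]
  · rw [sum_exp_odd_eq_zero, one_apply_ne hij, mul_zero]
    · have : (i : ℕ) ≠ (j : ℕ) := fun h ↦ hij (Fin.ext h)
      omega
    · have := i.2; have := j.2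
      rw [abs_lt]; constructor <;> omega

/-- The angle lies in `(0, π)` or in `(-π, 0)`; the shift by `1/2` keeps it off `0` on the diagonal.
-/
theorem sin_shift_sign {n : ℕ} (i j : Fin n) :
    ((i : ℕ) ≤ j → 0 < Real.sin (Real.pi * (((j : ℕ) : ℝ) - ((i : ℕ) : ℝ) + 1 / 2) / n)) ∧
    ((j : ℕ) < i → Real.sin (Real.pi * (((j : ℕ) : ℝ) - ((i : ℕ) : ℝ) + 1 / 2) / n) < 0) := by
  have hn : (0 : ℝ) < n := by exact_mod_cast Fin.pos i
  have hi : ((i : ℕ) : ℝ) + 1 ≤ n := by exact_mod_cast i.2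
  have hj : ((j : ℕ) : ℝ) + 1 ≤ n := by exact_mod_cast j.2
  have hi0 : (0 : ℝ) ≤ ((i : ℕ) : ℝ) := by positivity
  have hj0 : (0 : ℝ) ≤ ((j : ℕ) : ℝ) := by positivity
  have hpi := Real.pi_pos
  constructor <;> intro h
  · have h' : ((i : ℕ) : ℝ) ≤ ((j : ℕ) : ℝ) := by exact_mod_cast h
    apply Real.sin_pos_of_pos_of_lt_pi
    · apply div_pos _ hn
      apply mul_pos hpi; linarith
    · rw [div_lt_iff₀ hn]
      apply mul_lt_mul_of_pos_left _ hpi; linarith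
  · have h' : ((j : ℕ) : ℝ) + 1 ≤ ((i : ℕ) : ℝ) := by exact_mod_cast h
    apply Real.sin_neg_of_neg_of_neg_pi_lt
    · apply div_neg_of_neg_of_pos _ hn
      apply mul_neg_of_pos_of_neg hpi; linarith
    · rw [lt_div_iff₀ hn, ← neg_one_mul Real.pi, mul_comm (-1) Real.pi, mul_assoc]
      apply mul_lt_mul_of_pos_left _ hpi; linarith

theorem sin_shift_ne_zero {n : ℕ} (i j : Fin n) :
    Real.sin (Real.pi * (((j : ℕ) : ℝ) - ((i : ℕ) : ℝ) + 1 / 2) / n) ≠ 0 := by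
  rcases le_or_gt (i : ℕ) (j : ℕ) with h | h
  · exact ((sin_shift_sign i j).1 h).ne'
  · exact ((sin_shift_sign i j).2 h).ne

/-- The unimodular diagonal factor adds `π / (2n)` to the angle, that is, `1/2` to `j - i`.
Unitarity of the product then follows from that of the Fourier matrix. -/
theorem discreteHilbertMatrix_eq (n : ℕ) :
    discreteHilbertMatrix n = (oddFourierMatrix n)ᴴ *
      diagonal (fun k : Fin n ↦ -Complex.I *
        Complex.exp (((2 * (k : ℕ) + 1 : ℝ) : ℂ) * ((Real.pi / (2 * n) : ℝ) : ℂ) * Complex.I)) *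
      oddFourierMatrix n := by
  ext i j
  have hn : 0 < n := Fin.pos i
  have hne : (n : ℂ) ≠ 0 := by exact_mod_cast hn.ne'
  have h := neg_I_mul_sum_exp_odd hn (((j : ℕ) : ℤ) - ((i : ℕ) : ℤ))
    (by simpa using sin_shift_ne_zero i j)
  rw [mul_apply]
  simp only [mul_diagonal, conjTranspose_apply]
  have hterm : ∀ k : Fin n, star (oddFourierMatrix n k i) * (-Complex.I *
        Complex.exp (((2 * (k : ℕ) + 1 : ℝ) : ℂ) * ((Real.pi / (2 * n) : ℝ) : ℂ) * Complex.I)) *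
      oddFourierMatrix n k j = (n : ℂ)⁻¹ * -Complex.I * Complex.exp ((2 * (k : ℕ) + 1) *
        ((Real.pi * ((((j : ℕ) : ℤ) - ((i : ℕ) : ℤ) : ℤ) + 1 / 2) / n : ℝ) : ℂ) *
          Complex.I) := fun k ↦ by
    rw [mul_right_comm, star_oddFourierMatrix_mul_apply]
    rw [mul_mul_mul_comm, ← Complex.exp_add]
    congr 2
    push_cast
    field_simp
  rw [Finset.sum_congr rfl fun k _ ↦ hterm k, ← Finset.mul_sum,
    Fin.sum_univ_eq_sum_range (fun k ↦ Complex.exp ((2 * (k : ℕ) + 1) *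
      ((Real.pi * ((((j : ℕ) : ℤ) - ((i : ℕ) : ℤ) : ℤ) + 1 / 2) / n : ℝ) : ℂ) * Complex.I)) n,
    mul_assoc, h]
  simp only [discreteHilbertMatrix, of_apply]
  push_cast
  rw [mul_inv]

theorem discreteHilbertMatrix_mul_conjTranspose (n : ℕ) :
    discreteHilbertMatrix n * (discreteHilbertMatrix n)ᴴ = 1 := by
  have hF := conjTranspose_oddFourierMatrix_mul_self (n := n)
  have hF' : oddFourierMatrix n * (oddFourierMatrix n)ᴴ = 1 := mul_eq_one_comm.1 hF
  have hD : ∀ k : Fin n, (-Complex.I *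
        Complex.exp (((2 * (k : ℕ) + 1 : ℝ) : ℂ) * ((Real.pi / (2 * n) : ℝ) : ℂ) * Complex.I)) *
      star (-Complex.I *
        Complex.exp (((2 * (k : ℕ) + 1 : ℝ) : ℂ) * ((Real.pi / (2 * n) : ℝ) : ℂ) * Complex.I)) =
      1 := fun k ↦ by
    rw [star_mul', star_exp_ofReal_mul_ofReal_mul_I, mul_mul_mul_comm, ← Complex.exp_add, add_neg_cancel]
    simp
  rw [discreteHilbertMatrix_eq, conjTranspose_mul, conjTranspose_mul, conjTranspose_conjTranspose,
    diagonal_conjTranspose]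
  set F := oddFourierMatrix n
  set d := fun k : Fin n ↦ -Complex.I *
        Complex.exp (((2 * (k : ℕ) + 1 : ℝ) : ℂ) * ((Real.pi / (2 * n) : ℝ) : ℂ) * Complex.I)
  calc Fᴴ * diagonal d * F * (Fᴴ * (diagonal (star d) * F))
      = Fᴴ * diagonal d * (F * Fᴴ) * diagonal (star d) * F := by simp only [Matrix.mul_assoc]
    _ = Fᴴ * (diagonal d * diagonal (star d)) * F := by
      rw [hF', Matrix.mul_one, Matrix.mul_assoc Fᴴ]
    _ = 1 := by
      rw [diagonal_mul_diagonal]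
      simp only [Pi.star_apply]
      rw [show (fun i ↦ d i * star (d i)) = fun _ ↦ 1 from funext hD, diagonal_one,
        Matrix.mul_one, hF]

end CauchyMatrix

/-! ### Harmonic sums and divided differences -/

section Estimates

open Finset in
theorem log_le_sum_inv_abs_sub {n i : ℕ} (hi : i < n) :
    Real.log n ≤ ∑ j ∈ range n, |(j : ℝ) - i|⁻¹ := by
  -- There are `i` indices below `i` and `m` above, giving two harmonic sums; the term `j = i` is
  -- `0⁻¹ = 0`. The logarithms combine because `(i + 1)(m + 1) ≥ n`.
  obtain ⟨m, rfl⟩ : ∃ m, n = i + (1 + m) := ⟨n - i - 1, by omega⟩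
  have hlog : Real.log (i + (1 + m) : ℕ) ≤ Real.log (i + 1) + Real.log (m + 1) := by
    rw [← Real.log_mul (by positivity) (by positivity)]
    apply Real.log_le_log (by positivity)
    push_cast
    nlinarith [mul_nonneg (Nat.cast_nonneg (α := ℝ) i) (Nat.cast_nonneg (α := ℝ) m)]
  have hH : ∀ k : ℕ, Real.log (k + 1) ≤ ∑ j ∈ range k, ((j : ℝ) + 1)⁻¹ := fun k ↦ by
    have := log_add_one_le_harmonic k
    rw [harmonic] at this
    push_cast at this
    exact this
  rw [sum_range_add, sum_range_add]
  have h1 : ∑ j ∈ range i, |(j : ℝ) - i|⁻¹ = ∑ j ∈ range i, ((j : ℝ) + 1)⁻¹ := by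
    rw [← sum_range_reflect (fun j ↦ ((j : ℝ) + 1)⁻¹) i]
    refine sum_congr rfl fun j hj ↦ ?_
    have hj' : j + 1 ≤ i := mem_range.1 hj
    have e : ((i - 1 - j : ℕ) : ℝ) = i - 1 - j := by
      rw [Nat.sub_sub, Nat.cast_sub (by omega)]; push_cast; ring
    have : (j : ℝ) + 1 ≤ i := by exact_mod_cast hj'
    rw [e, abs_of_neg (by linarith)]
    congr 1; ring
  have h2 : ∑ j ∈ range m, |((i + (1 + j) : ℕ) : ℝ) - i|⁻¹ = ∑ j ∈ range m, ((j : ℝ) + 1)⁻¹ := by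
    refine sum_congr rfl fun j _ ↦ ?_
    push_cast
    rw [show (i : ℝ) + (1 + j) - i = j + 1 by ring, abs_of_nonneg (by positivity)]
  rw [h1, h2]
  have := hH i
  have := hH m
  simp only [range_one, sum_singleton, add_zero, sub_self, abs_zero, inv_zero, zero_add]
  linarith

theorem hFormula_neg (x : ℝ) : hFormula (-x) = hFormula x := by
  simp [hFormula]

theorem hFormula_exp_neg (k : ℕ) :
    hFormula (Real.exp (-(k + 1))) =
      Real.exp (-(k + 1)) * Real.log (k + 2) ^ (-(1 / 2) : ℝ) := by
  rw [hFormula, if_neg (Real.exp_ne_zero _), abs_of_pos (Real.exp_pos _), ← Real.exp_sub,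
    Real.log_exp]
  congr 3
  rw [abs_of_neg (by have : (0 : ℝ) ≤ k := Nat.cast_nonneg k
                     linarith)]
  ring

/-- The weight `log (k + 2) ^ (-1/2)` decreases in `k`, and `λ_j ≤ λ_i / 2` gives `(λ_i - λ_j) /
(λ_i + λ_j) ≥ 1/3`. -/
theorem le_hFormula_sub_div {n i j : ℕ} (hij : i < j) (hi : i < n) :
    1 / 3 * Real.log (n + 1) ^ (-(1 / 2) : ℝ) ≤
      (hFormula (Real.exp (-(i + 1))) - hFormula (Real.exp (-(j + 1)))) /
        (Real.exp (-(i + 1)) + Real.exp (-(j + 1))) := by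
  have hi' : (i : ℝ) + 1 ≤ n := by exact_mod_cast hi
  have hij' : (i : ℝ) + 1 ≤ j := by exact_mod_cast hij
  have hi0 : (0 : ℝ) ≤ i := Nat.cast_nonneg i
  have hpos : 0 < Real.log (i + 2) := Real.log_pos (by linarith)
  have hg1 : Real.log (n + 1) ^ (-(1 / 2) : ℝ) ≤ Real.log (i + 2) ^ (-(1 / 2) : ℝ) :=
    Real.rpow_le_rpow_of_nonpos hpos (Real.log_le_log (by linarith) (by linarith)) (by norm_num)
  have hg2 : Real.log (j + 2) ^ (-(1 / 2) : ℝ) ≤ Real.log (i + 2) ^ (-(1 / 2) : ℝ) :=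
    Real.rpow_le_rpow_of_nonpos hpos (Real.log_le_log (by linarith) (by linarith)) (by norm_num)
  have hlam : 2 * Real.exp (-(j + 1)) ≤ Real.exp (-(i + 1)) := by
    have h1 : (2 : ℝ) ≤ Real.exp (j - i) := by
      have := Real.add_one_le_exp ((j : ℝ) - i)
      linarith
    calc 2 * Real.exp (-((j : ℝ) + 1)) ≤ Real.exp (j - i) * Real.exp (-(j + 1)) := by gcongr
      _ = Real.exp (-(i + 1)) := by rw [← Real.exp_add]; congr 1; ring
  have hl1 := Real.exp_pos (-((i : ℝ) + 1))
  have hl2 := Real.exp_pos (-((j : ℝ) + 1))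
  have hg0 : 0 ≤ Real.log (n + 1) ^ (-(1 / 2) : ℝ) :=
    Real.rpow_nonneg (Real.log_nonneg (by linarith)) _
  rw [le_div_iff₀ (by positivity), hFormula_exp_neg, hFormula_exp_neg]
  set u := Real.exp (-((i : ℝ) + 1))
  set v := Real.exp (-((j : ℝ) + 1))
  set g := Real.log ((n : ℝ) + 1) ^ (-(1 / 2) : ℝ)
  set p := Real.log ((i : ℝ) + 2) ^ (-(1 / 2) : ℝ)
  set q := Real.log ((j : ℝ) + 2) ^ (-(1 / 2) : ℝ)
  calc 1 / 3 * g * (u + v) ≤ g * (u - v) := by nlinarith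
    _ ≤ p * (u - v) := by
      apply mul_le_mul_of_nonneg_right hg1; linarith
    _ ≤ u * p - v * q := by nlinarith

/-- Combine `sin t ≤ t` with `d + 1/2 ≤ 3d/2` for `d = j - i ≥ 1`. -/
theorem inv_mul_sin_shift_ge {n : ℕ} {i j : Fin n} (hij : i < j) :
    2 / (3 * Real.pi) * |((j : ℕ) : ℝ) - ((i : ℕ) : ℝ)|⁻¹ ≤
      (n * Real.sin (Real.pi * (((j : ℕ) : ℝ) - ((i : ℕ) : ℝ) + 1 / 2) / n))⁻¹ := by
  have hn : (0 : ℝ) < n := by exact_mod_cast Fin.pos i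
  have hij' : ((i : ℕ) : ℝ) + 1 ≤ ((j : ℕ) : ℝ) := by exact_mod_cast hij
  have hs := (sin_shift_sign i j).1 (le_of_lt hij)
  have hpi := Real.pi_pos
  have hd : 0 < ((j : ℕ) : ℝ) - ((i : ℕ) : ℝ) := by linarith
  have hle := Real.sin_le (x := Real.pi * (((j : ℕ) : ℝ) - ((i : ℕ) : ℝ) + 1 / 2) / n)
    (by positivity)
  rw [le_div_iff₀ hn] at hle
  rw [abs_of_pos hd, ← inv_div, ← mul_inv]
  apply inv_anti₀ (by positivity)
  nlinarith

theorem inv_mul_sin_shift_le {n : ℕ} {i j : Fin n} (hij : j < i) :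
    (n * Real.sin (Real.pi * (((j : ℕ) : ℝ) - ((i : ℕ) : ℝ) + 1 / 2) / n))⁻¹ ≤
      -(2 / (3 * Real.pi) * |((j : ℕ) : ℝ) - ((i : ℕ) : ℝ)|⁻¹) := by
  have hn : (0 : ℝ) < n := by exact_mod_cast Fin.pos i
  have hij' : ((j : ℕ) : ℝ) + 1 ≤ ((i : ℕ) : ℝ) := by exact_mod_cast hij
  have hs := (sin_shift_sign i j).2 hij
  have hpi := Real.pi_pos
  have hd : ((j : ℕ) : ℝ) - ((i : ℕ) : ℝ) < 0 := by linarith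
  have hle := Real.le_sin (x := Real.pi * (((j : ℕ) : ℝ) - ((i : ℕ) : ℝ) + 1 / 2) / n)
    (div_nonpos_of_nonpos_of_nonneg (mul_nonpos_of_nonneg_of_nonpos hpi.le (by linarith)) hn.le)
  rw [div_le_iff₀ hn] at hle
  rw [abs_of_neg hd, ← inv_div (3 * Real.pi) 2, ← mul_inv, le_neg, ← inv_neg]
  apply inv_anti₀ (by nlinarith)
  nlinarith

/-- Schur multiplication of the discrete Hilbert matrix by the divided differences of `hFormula`
at the points `exp (-(i + 1))` and `-exp (-(j + 1))` removes its cancellations. -/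
theorem le_hFormula_sub_div_mul_inv_sin {n : ℕ} (i j : Fin n) :
    2 / (9 * Real.pi) * Real.log (n + 1) ^ (-(1 / 2) : ℝ) *
        |((j : ℕ) : ℝ) - ((i : ℕ) : ℝ)|⁻¹ ≤
      (hFormula (Real.exp (-((i : ℕ) + 1))) - hFormula (Real.exp (-((j : ℕ) + 1)))) /
        (Real.exp (-((i : ℕ) + 1)) + Real.exp (-((j : ℕ) + 1))) *
      (n * Real.sin (Real.pi * (((j : ℕ) : ℝ) - ((i : ℕ) : ℝ) + 1 / 2) / n))⁻¹ := by
  have hpi := Real.pi_pos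
  have hg0 : 0 ≤ Real.log (n + 1) ^ (-(1 / 2) : ℝ) :=
    Real.rpow_nonneg (Real.log_nonneg (by linarith [Nat.cast_nonneg (α := ℝ) n])) _
  have e : 2 / (9 * Real.pi) * Real.log (n + 1) ^ (-(1 / 2) : ℝ) *
        |((j : ℕ) : ℝ) - ((i : ℕ) : ℝ)|⁻¹ = (1 / 3 * Real.log (n + 1) ^ (-(1 / 2) : ℝ)) *
        (2 / (3 * Real.pi) * |((j : ℕ) : ℝ) - ((i : ℕ) : ℝ)|⁻¹) := by
    field_simp
    ring
  rcases lt_trichotomy i j with h | h | h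
  · rw [e]
    have h1 := le_hFormula_sub_div (n := n) (i := i) (j := j) h i.2
    exact mul_le_mul h1 (inv_mul_sin_shift_ge h) (by positivity) (le_trans (by positivity) h1)
  -- On the diagonal both sides vanish, the left one because `0⁻¹ = 0`.
  · subst h; simp
  -- Below the diagonal both factors are negative, so their signs cancel.
  · have h1 := le_hFormula_sub_div (n := n) (i := j) (j := i) h j.2
    rw [← neg_sub (hFormula _), neg_div, add_comm (Real.exp _)] at h1
    rw [e, ← neg_mul_neg ((hFormula _ - _) / _)]
    exact mul_le_mul h1 (le_neg.1 (inv_mul_sin_shift_le h)) (by positivity)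
      (le_trans (by positivity) h1)

end Estimates

/-! ### The test operators and their commutators -/

section Operators

open Matrix
open scoped Matrix.Norms.L2Operator

theorem norm_star_dotProduct_mulVec_le {ι : Type*} [Fintype ι] [DecidableEq ι]
    (G : Matrix ι ι ℂ) (u v : ι → ℂ) :
    ‖star v ⬝ᵥ G *ᵥ u‖ ≤ ‖G‖ * ‖WithLp.toLp 2 u‖ * ‖WithLp.toLp 2 v‖ := by
  have h1 := G.l2_opNorm_mulVec (WithLp.toLp 2 u)
  have h2 := norm_inner_le_norm (𝕜 := ℂ) (WithLp.toLp 2 v) (WithLp.toLp 2 (G *ᵥ u))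
  rw [EuclideanSpace.inner_toLp_toLp, dotProduct_comm] at h2
  calc _ ≤ _ := h2
    _ ≤ ‖WithLp.toLp 2 v‖ * (‖G‖ * ‖WithLp.toLp 2 u‖) := by gcongr; exact h1
    _ = _ := by ring

/-- Matrices over a type with `N` elements, as operators on `ℓ²_N`. -/
noncomputable def matrixEquivOpL2 {ι : Type*} [Fintype ι] [DecidableEq ι] {N : ℕ}
    (e : ι ≃ Fin N) : Matrix ι ι ℂ ≃⋆ₐ[ℂ] OpL2 N :=
  (StarAlgEquiv.ofAlgEquiv (Matrix.reindexAlgEquiv ℂ ℂ e) fun x ↦ by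
    ext; simp [star_apply]).trans (Matrix.toEuclideanCLM (n := Fin N) (𝕜 := ℂ))

theorem norm_starAlgEquiv_apply {ι : Type*} [Fintype ι] [DecidableEq ι] {N : ℕ}
    (φ : Matrix ι ι ℂ ≃⋆ₐ[ℂ] OpL2 N) (G : Matrix ι ι ℂ) : ‖φ G‖ = ‖G‖ :=
  NonUnitalStarAlgHom.norm_map φ φ.injective G

/-- Diagonal matrices as a star homomorphism. -/
def diagonalStarAlgHom (ι : Type*) [Fintype ι] [DecidableEq ι] :
    (ι → ℂ) →⋆ₐ[ℂ] Matrix ι ι ℂ where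
  __ := Matrix.diagonalAlgHom (n := ι) (α := ℂ) ℂ
  map_star' v := by
    simp [star_eq_conjTranspose, diagonal_conjTranspose]

theorem cfc_starAlgEquiv_diagonal {ι : Type*} [Fintype ι] [DecidableEq ι] {N : ℕ}
    (φ : Matrix ι ι ℂ ≃⋆ₐ[ℂ] OpL2 N) {h : ℝ → ℝ} (hh : Continuous h) (d : ι → ℝ) :
    cfc h (φ (diagonal fun i ↦ (d i : ℂ))) = φ (diagonal fun i ↦ (h (d i) : ℂ)) := by
  -- The functional calculus is coordinatewise in `ι → ℂ` and is transported along `ψ`, with `h`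
  -- read as the complex function `z ↦ h (re z)`.
  let ψ : (ι → ℂ) →⋆ₐ[ℂ] OpL2 N := (φ : Matrix ι ι ℂ →⋆ₐ[ℂ] OpL2 N).comp (diagonalStarAlgHom ι)
  have hd : IsSelfAdjoint (fun i ↦ (d i : ℂ)) := by ext i; simp
  have hc : Continuous fun z : ℂ ↦ (h z.re : ℂ) := by fun_prop
  have hψ : Continuous ψ :=
    (LinearMap.continuous_of_finiteDimensional (ψ : (ι → ℂ) →ₗ[ℂ] OpL2 N))
  have h1 := StarAlgHom.map_cfc ψ (fun z : ℂ ↦ (h z.re : ℂ)) (fun i ↦ (d i : ℂ)) hc.continuousOn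
    hψ hd.isStarNormal (hd.map ψ).isStarNormal
  have h2 : cfc (fun z : ℂ ↦ (h z.re : ℂ)) (fun i ↦ (d i : ℂ)) = fun i ↦ (h (d i) : ℂ) := by
    rw [cfc_map_pi (S := ℂ) _ (fun i ↦ (d i : ℂ)) hc.continuousOn hd.isStarNormal
      fun i ↦ (inferInstance : IsStarNormal (d i : ℂ))]
    ext i
    exact cfc_algebraMap (A := ℂ) (d i : ℂ) _
  rw [h2] at h1
  exact (cfc_real_eq_complex h (hd.map ψ)).trans h1.symm

theorem diagonal_commutator_apply {ι : Type*} [Fintype ι] [DecidableEq ι] (d : ι → ℂ)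
    (G : Matrix ι ι ℂ) (a b : ι) :
    (diagonal d * G - G * diagonal d) a b = (d a - d b) * G a b := by
  simp only [Matrix.sub_apply, diagonal_mul, mul_diagonal]; ring

/-- The spectrum `exp (-(i + 1))`, `-exp (-(i + 1))`, `0`. -/
noncomputable def lacunarySpectrum (n : ℕ) : (Fin n ⊕ Fin n) ⊕ Unit → ℝ :=
  Sum.elim (Sum.elim (fun i ↦ Real.exp (-((i : ℕ) + 1))) fun i ↦ -Real.exp (-((i : ℕ) + 1)))
    fun _ ↦ 0

/-- The matrix `Y` with `(λ i + λ j) Y i j` equal to the discrete Hilbert matrix, where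
`λ i = exp (-(i + 1))`. -/
noncomputable def offDiagonalBlock (n : ℕ) : Matrix (Fin n) (Fin n) ℂ :=
  Matrix.of fun i j ↦ discreteHilbertMatrix n i j /
    ((Real.exp (-((i : ℕ) + 1)) + Real.exp (-((j : ℕ) + 1)) : ℝ) : ℂ)

/-- The self-adjoint matrix with off-diagonal blocks `offDiagonalBlock n` and its adjoint. -/
noncomputable def testMatrix (n : ℕ) :
    Matrix ((Fin n ⊕ Fin n) ⊕ Unit) ((Fin n ⊕ Fin n) ⊕ Unit) ℂ :=
  fromBlocks (fromBlocks 0 (offDiagonalBlock n) (offDiagonalBlock n)ᴴ 0) 0 0 0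

theorem isSelfAdjoint_testMatrix (n : ℕ) : IsSelfAdjoint (testMatrix n) := by
  simp [isSelfAdjoint_iff, star_eq_conjTranspose, testMatrix, fromBlocks_conjTranspose]

theorem commutator_testMatrix (n : ℕ) :
    (diagonal fun a ↦ (lacunarySpectrum n a : ℂ)) * testMatrix n -
      testMatrix n * (diagonal fun a ↦ (lacunarySpectrum n a : ℂ)) =
    fromBlocks (fromBlocks 0 (discreteHilbertMatrix n) (-(discreteHilbertMatrix n)ᴴ) 0) 0 0 0 := by
  have hne : ∀ i j : ℕ, (Real.exp (-((i : ℕ) + 1)) : ℂ) + Real.exp (-((j : ℕ) + 1)) ≠ 0 :=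
    fun i j ↦ by
      rw [← Complex.ofReal_add, Complex.ofReal_ne_zero]
      positivity
  ext a b
  rw [diagonal_commutator_apply]
  rcases a with (i | i) | i <;> rcases b with (j | j) | j
  case inl.inl.inl.inr =>
    simp only [lacunarySpectrum, testMatrix, offDiagonalBlock, Sum.elim_inl, Sum.elim_inr,
      fromBlocks_apply₁₁, fromBlocks_apply₁₂, of_apply, Complex.ofReal_neg, Complex.ofReal_add]
    have := hne i j
    rw [sub_neg_eq_add, mul_div_cancel₀ _ this]
  case inl.inr.inl.inl =>
    simp only [lacunarySpectrum, testMatrix, offDiagonalBlock, Sum.elim_inl, Sum.elim_inr,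
      fromBlocks_apply₁₁, fromBlocks_apply₂₁, of_apply, Complex.ofReal_neg, Complex.ofReal_add,
      conjTranspose_apply, star_div₀, star_add, Complex.star_def, Complex.conj_ofReal,
      Matrix.neg_apply]
    have := hne j i
    rw [add_comm] at this
    rw [← neg_add', add_comm (Complex.ofReal (Real.exp (-((j : ℕ) + 1)))), neg_mul,
      mul_div_cancel₀ _ this]
  all_goals simp [testMatrix]

theorem norm_commutator_testMatrix_le (n : ℕ) :
    ‖(diagonal fun a ↦ (lacunarySpectrum n a : ℂ)) * testMatrix n -
      testMatrix n * (diagonal fun a ↦ (lacunarySpectrum n a : ℂ))‖ ≤ 1 := by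
  rw [commutator_testMatrix]
  have h1 := discreteHilbertMatrix_mul_conjTranspose n
  have h2 : (discreteHilbertMatrix n)ᴴ * discreteHilbertMatrix n = 1 := mul_eq_one_comm.1 h1
  set Z := discreteHilbertMatrix n
  set G : Matrix ((Fin n ⊕ Fin n) ⊕ Unit) ((Fin n ⊕ Fin n) ⊕ Unit) ℂ :=
    fromBlocks (fromBlocks 0 Z (-Zᴴ) 0) 0 0 0
  -- Unitarity of `Z` makes `G` a partial isometry.
  have hG : Gᴴ * G = diagonal (Sum.elim (fun _ ↦ 1) fun _ ↦ 0) := by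
    simp [G, fromBlocks_conjTranspose, fromBlocks_multiply, h1, h2, ← fromBlocks_diagonal,
      fromBlocks_one]
  have hle : ‖G‖ * ‖G‖ ≤ 1 := by
    rw [← l2_opNorm_conjTranspose_mul_self, hG, l2_opNorm_diagonal,
      pi_norm_le_iff_of_nonneg zero_le_one]
    rintro (a | a) <;> simp
  nlinarith [norm_nonneg G]

theorem norm_toLp_eq_sqrt_of_sum_sq_eq {ι : Type*} [Fintype ι] {n : ℕ} {u : ι → ℂ}
    (hu : ∑ a, ‖u a‖ ^ 2 = n) : ‖WithLp.toLp 2 u‖ = √n := by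
  rw [EuclideanSpace.norm_eq]; simp [hu]

theorem le_norm_commutator_testMatrix {n : ℕ} (hn : 3 ≤ n) {h : ℝ → ℝ}
    (hh : IsPeriodicExtension h) :
    1 / (9 * Real.pi) * Real.log n ^ (1 / 2 : ℝ) ≤
      ‖(diagonal fun a ↦ (h (lacunarySpectrum n a) : ℂ)) * testMatrix n -
        testMatrix n * (diagonal fun a ↦ (h (lacunarySpectrum n a) : ℂ))‖ := by
  set G := (diagonal fun a ↦ (h (lacunarySpectrum n a) : ℂ)) * testMatrix n -
        testMatrix n * (diagonal fun a ↦ (h (lacunarySpectrum n a) : ℂ)) with hG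
  have hn0 : (3 : ℝ) ≤ n := by exact_mod_cast hn
  have hlog : 0 < Real.log n := Real.log_pos (by linarith)
  have hpi := Real.pi_pos
  set κ := 2 / (9 * Real.pi) * Real.log (n + 1) ^ (-(1 / 2) : ℝ)
  have hκ0 : 0 ≤ κ := mul_nonneg (by positivity)
    (Real.rpow_nonneg (Real.log_nonneg (by linarith)) _)
  have hκ : 1 / (9 * Real.pi) * Real.log n ^ (1 / 2 : ℝ) ≤ κ * Real.log n := by
    -- The factor 4 is chosen for `4 ^ (-1/2) = 1/2`, which turns `2 / (9π)` into `1 / (9π)`.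
    have hle : Real.log (n + 1) ≤ 4 * Real.log n := by
      have : Real.log (n + 1) ≤ Real.log ((n : ℝ) ^ 4) := by
        apply Real.log_le_log (by linarith)
        nlinarith [pow_le_pow_right₀ (by linarith : (1 : ℝ) ≤ n) (by norm_num : 2 ≤ 4)]
      rwa [Real.log_pow] at this
    have h1 : (4 * Real.log n) ^ (-(1 / 2) : ℝ) ≤ Real.log (n + 1) ^ (-(1 / 2) : ℝ) :=
      Real.rpow_le_rpow_of_nonpos (Real.log_pos (by linarith)) hle (by norm_num)
    have h4 : (4 : ℝ) ^ (-(1 / 2) : ℝ) = 1 / 2 := by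
      rw [show (4 : ℝ) = 2 ^ (2 : ℝ) by norm_num, ← Real.rpow_mul (by norm_num)]
      norm_num
    rw [Real.mul_rpow (by norm_num) hlog.le, h4] at h1
    have h2 : Real.log n ^ (1 / 2 : ℝ) = Real.log n ^ (-(1 / 2) : ℝ) * Real.log n := by
      rw [← Real.rpow_add_one hlog.ne']; norm_num
    calc 1 / (9 * Real.pi) * Real.log n ^ (1 / 2 : ℝ)
        = 2 / (9 * Real.pi) * (1 / 2 * Real.log n ^ (-(1 / 2) : ℝ)) * Real.log n := by
          rw [h2]; ring
      _ ≤ κ * Real.log n :=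
        mul_le_mul_of_nonneg_right (mul_le_mul_of_nonneg_left h1 (by positivity)) hlog.le
  refine hκ.trans ?_
  have hval : ∀ i : Fin n, h (Real.exp (-((i : ℕ) + 1))) = hFormula (Real.exp (-((i : ℕ) + 1))) ∧
      h (-Real.exp (-((i : ℕ) + 1))) = hFormula (Real.exp (-((i : ℕ) + 1))) := fun i ↦ by
    have h1 : Real.exp (-(((i : ℕ) : ℝ) + 1)) ≤ (Real.exp 1)⁻¹ := by
      rw [← Real.exp_neg]
      exact Real.exp_le_exp.2 (by linarith [Nat.cast_nonneg (α := ℝ) (i : ℕ)])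
    have h2 := Real.exp_pos (-(((i : ℕ) : ℝ) + 1))
    refine ⟨hh.eqOn ⟨by linarith, h1⟩, ?_⟩
    rw [hh.eqOn ⟨by linarith, by linarith⟩, hFormula_neg]
  have hentry : ∀ i j : Fin n, G (Sum.inl (Sum.inl i)) (Sum.inl (Sum.inr j)) =
      (((hFormula (Real.exp (-((i : ℕ) + 1))) - hFormula (Real.exp (-((j : ℕ) + 1)))) /
        (Real.exp (-((i : ℕ) + 1)) + Real.exp (-((j : ℕ) + 1))) *
      (n * Real.sin (Real.pi * (((j : ℕ) : ℝ) - ((i : ℕ) : ℝ) + 1 / 2) / n))⁻¹ : ℝ) : ℂ) := by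
    intro i j
    rw [hG, diagonal_commutator_apply]
    simp only [lacunarySpectrum, testMatrix, offDiagonalBlock, Sum.elim_inl, Sum.elim_inr,
      fromBlocks_apply₁₁, fromBlocks_apply₁₂, of_apply, (hval _).1, (hval _).2,
      discreteHilbertMatrix]
    push_cast
    ring
  -- The two indicator vectors pick out the sum of all entries of the upper right corner; each has
  -- norm `√n`, so the sum is at most `‖G‖ * n`.
  have key := norm_star_dotProduct_mulVec_le G (Sum.elim (Sum.elim (fun _ ↦ 0) fun _ ↦ 1) fun _ ↦ 0)
    (Sum.elim (Sum.elim (fun _ ↦ 1) fun _ ↦ 0) fun _ ↦ 0)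
  rw [norm_toLp_eq_sqrt_of_sum_sq_eq (n := n) (by simp), norm_toLp_eq_sqrt_of_sum_sq_eq (n := n) (by simp), mul_assoc,
    Real.mul_self_sqrt (Nat.cast_nonneg n)] at key
  simp only [dotProduct, mulVec, Fintype.sum_sum_type, Pi.star_apply, Sum.elim_inl, Sum.elim_inr,
    star_one, star_zero, one_mul, mul_one, mul_zero, zero_mul, Finset.sum_const_zero, zero_add,
    add_zero, hentry] at key
  simp only [← Complex.ofReal_sum] at key
  rw [Complex.norm_real] at key
  have hsum : n * (κ * Real.log n) ≤ ‖G‖ * n := by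
    refine le_trans ?_ ((le_abs_self _).trans key)
    calc n * (κ * Real.log n) = ∑ i : Fin n, κ * Real.log n := by simp
      _ ≤ ∑ i : Fin n, ∑ j : Fin n, κ * |((j : ℕ) : ℝ) - ((i : ℕ) : ℝ)|⁻¹ := by
        refine Finset.sum_le_sum fun i _ ↦ ?_
        rw [← Finset.mul_sum,
          Fin.sum_univ_eq_sum_range (fun j ↦ |(j : ℝ) - ((i : ℕ) : ℝ)|⁻¹) n]
        exact mul_le_mul_of_nonneg_left (log_le_sum_inv_abs_sub i.2) hκ0
      _ ≤ _ := Finset.sum_le_sum fun i _ ↦ Finset.sum_le_sum fun j _ ↦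
        le_hFormula_sub_div_mul_inv_sin i j
  rw [mul_comm] at hsum
  exact le_of_mul_le_mul_right hsum (by linarith)

end Operators

theorem theorem4p1 :
    ∃ c : ℝ, 0 < c ∧
      ∀ h : ℝ → ℝ, IsPeriodicExtension h →
        ∀ n : ℕ, 3 ≤ n →
          ∃ A B : OpL2 (2 * n + 1),
            IsSelfAdjoint A ∧ IsSelfAdjoint B ∧ B ≠ 0 ∧
            (0 : ℂ) ∈ spectrum ℂ A ∧
            c * (Real.log n) ^ (1 / 2 : ℝ) * ‖B‖ ≤ ‖cfc h (A + B) - cfc h A‖ ∧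
            ∃ S : unitary (OpL2 (2 * n + 1)),
              A + B = ((S⁻¹ : unitary (OpL2 (2 * n + 1))) : OpL2 (2 * n + 1)) * A *
                (S : OpL2 (2 * n + 1)) := by
  have hpi := Real.pi_pos
  -- The constant is the commutator bound `1 / (9π)` divided by the Cayley loss 4.
  refine ⟨1 / (36 * Real.pi), by positivity, fun h hh n hn ↦ ?_⟩
  have hlog : 0 < Real.log n := Real.log_pos (by exact_mod_cast (by omega : 1 < n))
  let φ := matrixEquivOpL2 (Fintype.equivFinOfCardEq
    (show Fintype.card ((Fin n ⊕ Fin n) ⊕ Unit) = 2 * n + 1 by simp; omega))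
  have hc := hh.contDiff.continuous
  have hlow := le_norm_commutator_testMatrix hn hh
  have hup := norm_commutator_testMatrix_le n
  have hK : 0 < 1 / (9 * Real.pi) * Real.log n ^ (1 / 2 : ℝ) := by positivity
  rw [← norm_starAlgEquiv_apply φ, map_sub, map_mul, map_mul,
    ← cfc_starAlgEquiv_diagonal φ hc] at hlow
  rw [← norm_starAlgEquiv_apply φ, map_sub, map_mul, map_mul] at hup
  have hA : IsSelfAdjoint (φ (Matrix.diagonal fun a ↦ (lacunarySpectrum n a : ℂ))) := by
    refine IsSelfAdjoint.map ?_ φ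
    rw [isSelfAdjoint_iff, Matrix.star_eq_conjTranspose, Matrix.diagonal_conjTranspose]
    congr 1; ext a; simp
  obtain ⟨B, hB, hB0, hle, hS⟩ := exists_perturbation_of_norm_commutator_le hc hA
    ((isSelfAdjoint_testMatrix n).map φ) hK.le (norm_pos_iff.1 (hK.trans_le hlow))
    ((mul_le_of_le_one_right hK.le hup).trans hlow)
  refine ⟨_, B, hA, hB, hB0, ?_, ?_, hS⟩
  -- The extra `Unit` index supplies the eigenvalue `0` and the odd dimension.
  · rw [AlgEquiv.spectrum_eq φ, spectrum_diagonal]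
    exact ⟨Sum.inr (), by simp [lacunarySpectrum]⟩
  · convert hle using 2
    field_simp
    norm_num
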